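/- Let $0<\mu\le\nu<1$, $K\in(0,1]$ and $L\ge 0$. There is a finite constant $C=C(\mu,\nu,K,L)>0$ with the following property. Let $H:[0,\infty)\to[\mu,\nu]$ be Hölder continuous with exponent $\beta>0$ and Hölder constant $L$, that is, $|H(t)-H(s)|\le L|t-s|^{\beta}$ for all $t,s\ge 0$, and suppose that $\sup_{t\ge 0}H(t)<\beta$. Let $B^{H(\cdot),K}=(B^{H(t),K}_t)_{t\ge 0}$ be a centred Gaussian process, starting from zero almost surely, with covariance function $$\mathbb{E}\big(B^{H(t),K}_tB^{H(s),K}_s\big)=D\big(H(t),H(s)\big)^K\Big[\big(t^{H(t)+H(s)}+s^{H(t)+H(s)}\big)^{K}-|t-s|^{(H(t)+H(s))K}\Big],\qquad t,s\ge 0,$$ where $$D(x,y)=\frac{\sqrt{\Gamma(2x+1)\Gamma(2y+1)\sin(\pi x)\sin(\pi y)}}{2\,\Gamma(x+y+1)\sin\big(\frac{\pi(x+y)}{2}\big)}.$$ Then for all $t,s\in[0,1]$, $$\mathbb{E}\big(B^{H(t),K}_t-B^{H(s),K}_s\big)^2\le C\,|t-s|^{2\max(H(t),H(s))K}.$$ 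-/

import Mathlib

open MeasureTheory ProbabilityTheory
open scoped NNReal

/-- The normalising function `D(x, y)` of the standard multifractional Brownian motion. -/
noncomputable def mbmD (x y : ℝ) : ℝ :=
  Real.sqrt (Real.Gamma (2 * x + 1) * Real.Gamma (2 * y + 1)
      * Real.sin (Real.pi * x) * Real.sin (Real.pi * y))
    / (2 * Real.Gamma (x + y + 1) * Real.sin (Real.pi * (x + y) / 2))

/-- The covariance function `R^{H(.),K}(t, s)`. -/
noncomputable def multiBifBmCov (H : ℝ≥0 → ℝ) (K : ℝ) (t s : ℝ≥0) : ℝ :=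
  mbmD (H t) (H s) ^ K *
    (((t : ℝ) ^ (H t + H s) + (s : ℝ) ^ (H t + H s)) ^ K
      - |(t : ℝ) - (s : ℝ)| ^ ((H t + H s) * K))

/-- `B` is (a version of) the process `B^{H(.),K}` on `[0, ∞)`: a centred Gaussian process,
starting from zero, with covariance function `R^{H(.),K}`. -/
structure IsMultiBifBm {Ω : Type*} [MeasurableSpace Ω] (P : Measure Ω)
    (H : ℝ≥0 → ℝ) (K : ℝ) (B : ℝ≥0 → Ω → ℝ) : Prop where
  isGaussianProcess : IsGaussianProcess B P
  centred : ∀ t, ∫ ω, B t ω ∂P = 0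
  start_zero : ∀ᵐ ω ∂P, B 0 ω = 0
  covariance_eq : ∀ t s, cov[B t, B s; P] = multiBifBmCov H K t s

/-! Write `u = |t - s|`, `p = H t * K`, `q = H s * K`, `M = max (H t) (H s)`. Since `(2D)^K` falls
short of `1` by at most `O((H t - H s)^2)` (`one_sub_le_two_mul_mbmD_sq`), concavity of `x ^ K`
reduces the increment's variance to `t^(2p) + s^(2q) - t^(p+q) - s^(p+q)`, plus `O((H t - H s)^2)`
and `O(u^(p+q))`. The cross difference is `O(|p-q|^2 + |p-q| u^(min p q))`
(`rpow_cross_difference_le`). As `M * K ≤ M ≤ β`, the Hölder bound gives `|H t - H s| ≤ L u^(M*K)`.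
Replacing `min p q` by `M * K` costs only a constant factor (`rpow_le_exp_mul_rpow`), so every term
is `O(u^(2*M*K))`. -/

/-! ### Powers with varying exponent -/

/-- Both `1 - r^(q-p) ≤ -(q-p) log r` and `r^p (-log r) ≤ 1/p` come from `1 + x ≤ exp x`. -/
theorem rpow_sub_rpow_le_div {p q r : ℝ} (hp : 0 < p) (hpq : p ≤ q) (hr : 0 ≤ r) :
    r ^ p - r ^ q ≤ (q - p) / p := by
  rcases hr.eq_or_lt with rfl | hr
  · rw [Real.zero_rpow hp.ne', Real.zero_rpow (hp.trans_le hpq).ne', sub_zero]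
    exact div_nonneg (sub_nonneg.2 hpq) hp.le
  have h1 : r ^ q = r ^ p * r ^ (q - p) := by rw [← Real.rpow_add hr]; ring_nf
  have h2 : 1 + Real.log r * (q - p) ≤ r ^ (q - p) := by
    rw [Real.rpow_def_of_pos hr, add_comm]; exact Real.add_one_le_exp _
  have h3 : r ^ p * (-Real.log r) ≤ 1 / p := by
    have h := Real.add_one_le_exp (-(Real.log r * p))
    have h4 : r ^ p * Real.exp (-(Real.log r * p)) = 1 := by
      rw [Real.rpow_def_of_pos hr, ← Real.exp_add]; simp
    have h5 : 0 < r ^ p := Real.rpow_pos_of_pos hr p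
    rw [le_div_iff₀ hp]
    nlinarith [mul_le_mul_of_nonneg_left h h5.le]
  have h5 : 0 < r ^ p := Real.rpow_pos_of_pos hr p
  have h6 := mul_le_mul_of_nonneg_left h2 h5.le
  have h7 := mul_le_mul_of_nonneg_left h3 (sub_nonneg.2 hpq)
  rw [h1, div_eq_mul_one_div]
  linarith

theorem sq_rpow_sub_rpow_le {m p q r : ℝ} (hm : 0 < m) (hp : m ≤ p) (hq : m ≤ q) (hr : 0 ≤ r)
    (hr1 : r ≤ 1) : (r ^ p - r ^ q) ^ 2 ≤ (|p - q| / m) ^ 2 := by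
  wlog hpq : p ≤ q generalizing p q
  · rw [abs_sub_comm, ← neg_sub, neg_sq]
    exact this hq hp (le_of_not_ge hpq)
  have hp0 := hm.trans_le hp
  have h0 : 0 ≤ r ^ p - r ^ q :=
    sub_nonneg.2 (Real.rpow_le_rpow_of_exponent_ge' hr hr1 hp0.le hpq)
  refine pow_le_pow_left₀ h0 ?_ 2
  rw [abs_sub_comm, abs_of_nonneg (sub_nonneg.2 hpq)]
  exact (rpow_sub_rpow_le_div hp0 hpq hr).trans
    (div_le_div_of_nonneg_left (sub_nonneg.2 hpq) hm hp)

theorem abs_deriv_rpow_sub_rpow_le {p q r : ℝ} (hp : 0 < p) (hpq : p ≤ q) (hr : 0 < r)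
    (hr1 : r ≤ 1) :
    |2 * p * r ^ (2 * p - 1) - 2 * q * r ^ (2 * q - 1)| ≤ 6 * (q - p) * r ^ (p - 1) := by
  have h1 : r ^ (2 * p) - r ^ (2 * q) ≤ 2 * (q - p) / p * r ^ p := by
    -- Factoring out `r ^ p` first keeps a decaying factor, which makes the final bound integrable
    -- at `0`.
    have h := rpow_sub_rpow_le_div hp (show p ≤ 2 * q - p by linarith) hr.le
    have h2 : r ^ (2 * p) = r ^ p * r ^ p := by rw [← Real.rpow_add hr]; ring_nf
    have h3 : r ^ (2 * q) = r ^ p * r ^ (2 * q - p) := by rw [← Real.rpow_add hr]; ring_nf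
    have h4 := mul_le_mul_of_nonneg_left h (Real.rpow_nonneg hr.le p)
    rw [h2, h3]
    calc _ = r ^ p * (r ^ p - r ^ (2 * q - p)) := by ring
      _ ≤ _ := h4
      _ = _ := by ring
  have h2 : r ^ (2 * q) ≤ r ^ p := Real.rpow_le_rpow_of_exponent_ge hr hr1 (by linarith)
  have h3 : r ^ (2 * q) ≤ r ^ (2 * p) := Real.rpow_le_rpow_of_exponent_ge hr hr1 (by linarith)
  have h4 : 0 ≤ r ^ (2 * q) := Real.rpow_nonneg hr.le _
  rw [Real.rpow_sub_one hr.ne', Real.rpow_sub_one hr.ne', Real.rpow_sub_one hr.ne',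
    mul_div_assoc', mul_div_assoc', mul_div_assoc', ← sub_div, abs_div, abs_of_pos hr]
  refine div_le_div_of_nonneg_right ?_ hr.le
  -- The numerator is `2p (r^(2p) - r^(2q)) - 2(q-p) r^(2q)`; the two pieces contribute `4` and `2`
  -- to the constant `6`.
  have h5 := mul_le_mul_of_nonneg_left h1 (show 0 ≤ 2 * p by linarith)
  have h6 : 2 * p * (2 * (q - p) / p * r ^ p) = 4 * (q - p) * r ^ p := by field_simp; ring
  have h7 := mul_le_mul_of_nonneg_left h2 (sub_nonneg.2 hpq)
  have h8 := mul_nonneg (sub_nonneg.2 hpq) h4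
  have h9 := mul_le_mul_of_nonneg_left h3 hp.le
  rw [abs_le]
  constructor <;> nlinarith

theorem monotoneOn_of_abs_deriv_le {f g f' g' : ℝ → ℝ} (hf : Continuous f) (hg : Continuous g)
    (hf' : ∀ r, 0 < r → HasDerivAt f (f' r) r) (hg' : ∀ r, 0 < r → HasDerivAt g (g' r) r)
    (h : ∀ r, 0 < r → r ≤ 1 → |f' r| ≤ g' r) : MonotoneOn (g - f) (Set.Icc 0 1) := by
  refine monotoneOn_of_deriv_nonneg (convex_Icc 0 1) (hg.sub hf).continuousOn ?_ ?_
  · rw [interior_Icc]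
    exact fun r hr => ((hg' r hr.1).sub (hf' r hr.1)).differentiableAt.differentiableWithinAt
  · rw [interior_Icc]
    intro r hr
    rw [((hg' r hr.1).sub (hf' r hr.1)).deriv]
    exact sub_nonneg.2 ((le_abs_self _).trans (h r hr.1 hr.2.le))

/-- `g - f` and `g + f` are both monotone. Derivatives are needed only for `r > 0`, which allows `g'
= r^(m-1)`, singular at `0`. -/
theorem abs_sub_le_of_abs_deriv_le {f g f' g' : ℝ → ℝ} (hf : Continuous f) (hg : Continuous g)
    (hf' : ∀ r, 0 < r → HasDerivAt f (f' r) r) (hg' : ∀ r, 0 < r → HasDerivAt g (g' r) r)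
    (h : ∀ r, 0 < r → r ≤ 1 → |f' r| ≤ g' r) {s t : ℝ} (hs : 0 ≤ s) (hst : s ≤ t) (ht : t ≤ 1) :
    |f t - f s| ≤ g t - g s := by
  have hs' : s ∈ Set.Icc (0 : ℝ) 1 := ⟨hs, hst.trans ht⟩
  have ht' : t ∈ Set.Icc (0 : ℝ) 1 := ⟨hs.trans hst, ht⟩
  have h1 := monotoneOn_of_abs_deriv_le hf hg hf' hg' h hs' ht' hst
  have h2 := monotoneOn_of_abs_deriv_le hf.neg hg (fun r hr => (hf' r hr).neg) hg'
    (fun r hr hr1 => by rw [abs_neg]; exact h r hr hr1) hs' ht' hst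
  simp only [Pi.sub_apply, Pi.neg_apply] at h1 h2
  rw [abs_le]
  constructor <;> linarith

theorem rpow_sub_rpow_le_rpow_sub {p s t : ℝ} (hp : 0 ≤ p) (hp1 : p ≤ 1) (hs : 0 ≤ s)
    (hst : s ≤ t) : t ^ p - s ^ p ≤ (t - s) ^ p := by
  have h := Real.rpow_add_le_add_rpow (sub_nonneg.2 hst) hs hp hp1
  rw [sub_add_cancel] at h
  linarith

theorem abs_rpow_sub_rpow_increment_le {m p q s t : ℝ} (hm : 0 < m) (hm1 : m ≤ 1)
    (hmin : m = min p q) (hs : s ∈ Set.Icc (0 : ℝ) 1) (ht : t ∈ Set.Icc (0 : ℝ) 1) :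
    |(t ^ (2 * p) - t ^ (2 * q)) - (s ^ (2 * p) - s ^ (2 * q))|
      ≤ 6 * |p - q| / m * |t - s| ^ m := by
  wlog hst : s ≤ t generalizing s t
  · rw [abs_sub_comm, abs_sub_comm t s]
    exact this ht hs (le_of_not_ge hst)
  wlog hpq : p ≤ q generalizing p q
  · have := this (by rw [hmin, min_comm]) (le_of_not_ge hpq)
    rw [abs_sub_comm p q]
    refine le_trans (le_of_eq ?_) this
    rw [← abs_neg]; ring_nf
  rw [min_eq_left hpq] at hmin
  subst hmin
  have hq := hm.trans_le hpq
  rw [abs_sub_comm m q, abs_of_nonneg (sub_nonneg.2 hpq), abs_of_nonneg (sub_nonneg.2 hst)]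
  have hc : 0 ≤ 6 * (q - m) / m := div_nonneg (by linarith) hm.le
  have key := abs_sub_le_of_abs_deriv_le (f := fun r : ℝ => r ^ (2 * m) - r ^ (2 * q))
    (g := fun r : ℝ => 6 * (q - m) / m * r ^ m)
    (f' := fun r => 2 * m * r ^ (2 * m - 1) - 2 * q * r ^ (2 * q - 1))
    (g' := fun r => 6 * (q - m) / m * (m * r ^ (m - 1)))
    ((Real.continuous_rpow_const (by linarith)).sub (Real.continuous_rpow_const (by linarith)))
    ((Real.continuous_rpow_const hm.le).const_mul _)
    (fun r hr => (Real.hasDerivAt_rpow_const (Or.inl hr.ne')).sub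
      (Real.hasDerivAt_rpow_const (Or.inl hr.ne')))
    (fun r hr => (Real.hasDerivAt_rpow_const (Or.inl hr.ne')).const_mul _)
    (fun r hr hr1 => by
      refine (abs_deriv_rpow_sub_rpow_le hm hpq hr hr1).trans (le_of_eq ?_)
      field_simp) hs.1 hst ht.2
  refine key.trans ?_
  have := mul_le_mul_of_nonneg_left (rpow_sub_rpow_le_rpow_sub hm.le hm1 hs.1 hst) hc
  linarith

/-- The left side is half of `(t^p - t^q)^2 + (s^p - s^q)^2` plus half of the increment of `r^(2p) -
r^(2q)` from `s` to `t`. -/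
theorem rpow_cross_difference_le {m p q s t : ℝ} (hm : 0 < m) (hm1 : m ≤ 1)
    (hmin : m = min p q) (hs : s ∈ Set.Icc (0 : ℝ) 1) (ht : t ∈ Set.Icc (0 : ℝ) 1) :
    t ^ (2 * p) + s ^ (2 * q) - t ^ (p + q) - s ^ (p + q)
      ≤ (|p - q| / m) ^ 2 + 3 * |p - q| / m * |t - s| ^ m := by
  have hp : m ≤ p := hmin ▸ min_le_left p q
  have hq : m ≤ q := hmin ▸ min_le_right p q
  have h1 := sq_rpow_sub_rpow_le hm hp hq ht.1 ht.2
  have h2 := sq_rpow_sub_rpow_le hm hp hq hs.1 hs.2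
  have h3 := (le_abs_self _).trans (abs_rpow_sub_rpow_increment_le hm hm1 hmin hs ht)
  have hsq : ∀ r x : ℝ, 0 ≤ r → r ^ (2 * x) = (r ^ x) ^ 2 := fun r x hr => by
    rw [mul_comm, Real.rpow_mul_natCast hr x 2 |>.symm]; norm_num
  have hadd : ∀ r : ℝ, 0 ≤ r → r ^ (p + q) = r ^ p * r ^ q := fun r hr =>
    Real.rpow_add_of_nonneg hr (by linarith) (by linarith)
  rw [hsq t p ht.1, hsq t q ht.1, hsq s p hs.1, hsq s q hs.1] at h3
  rw [hsq t p ht.1, hsq s q hs.1, hadd t ht.1, hadd s hs.1]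
  have h4 : 3 * |p - q| / m * |t - s| ^ m = 1 / 2 * (6 * |p - q| / m * |t - s| ^ m) := by ring
  rw [h4]
  nlinarith

/-! ### The normalising function `D` -/

theorem Real.Gamma_midpoint_sq_le {x y : ℝ} (hx : 0 < x) (hy : 0 < y) :
    Real.Gamma ((x + y) / 2) ^ 2 ≤ Real.Gamma x * Real.Gamma y := by
  have h := Real.Gamma_mul_add_mul_le_rpow_Gamma_mul_rpow_Gamma hx hy
    (a := 1 / 2) (b := 1 / 2) (by norm_num) (by norm_num) (by norm_num)
  have e : 1 / 2 * x + 1 / 2 * y = (x + y) / 2 := by ring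
  rw [e, ← Real.sqrt_eq_rpow, ← Real.sqrt_eq_rpow,
    ← Real.sqrt_mul (Real.Gamma_pos_of_pos hx).le] at h
  have h0 : 0 < Real.Gamma ((x + y) / 2) := Real.Gamma_pos_of_pos (by linarith)
  exact (Real.le_sqrt' h0).1 h

theorem Real.sin_mul_sin_eq_sq_sub_sq (x y : ℝ) :
    Real.sin x * Real.sin y = Real.sin ((x + y) / 2) ^ 2 - Real.sin ((x - y) / 2) ^ 2 := by
  have hx : x = (x + y) / 2 + (x - y) / 2 := by ring
  have hy : y = (x + y) / 2 - (x - y) / 2 := by ring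
  generalize (x + y) / 2 = m at *
  generalize (x - y) / 2 = d at *
  rw [hx, hy, Real.sin_add, Real.sin_sub]
  linear_combination Real.sin m ^ 2 * Real.sin_sq_add_cos_sq d
    - Real.sin d ^ 2 * Real.sin_sq_add_cos_sq m

theorem Real.sin_pi_mul_pos {x : ℝ} (h0 : 0 < x) (h1 : x < 1) : 0 < Real.sin (Real.pi * x) :=
  Real.sin_pos_of_pos_of_lt_pi (mul_pos Real.pi_pos h0) (by nlinarith [Real.pi_pos])

theorem mbmD_self {x : ℝ} (h0 : 0 < x) (h1 : x < 1) : mbmD x x = 1 / 2 := by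
  have hs := Real.sin_pi_mul_pos h0 h1
  have hG : 0 < Real.Gamma (2 * x + 1) := Real.Gamma_pos_of_pos (by linarith)
  have e1 : x + x + 1 = 2 * x + 1 := by ring
  have e2 : Real.pi * (x + x) / 2 = Real.pi * x := by ring
  have e3 : Real.Gamma (2 * x + 1) * Real.Gamma (2 * x + 1) * Real.sin (Real.pi * x)
      * Real.sin (Real.pi * x) = (Real.Gamma (2 * x + 1) * Real.sin (Real.pi * x)) ^ 2 := by ring
  rw [mbmD, e1, e2, e3, Real.sqrt_sq (by positivity)]
  generalize Real.sin (Real.pi * x) = S at *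
  field_simp

theorem mbmD_pos {x y : ℝ} (hx : x ∈ Set.Ioo (0 : ℝ) 1) (hy : y ∈ Set.Ioo (0 : ℝ) 1) :
    0 < mbmD x y := by
  have h1 := Real.sin_pi_mul_pos hx.1 hx.2
  have h2 := Real.sin_pi_mul_pos hy.1 hy.2
  have h3 : 0 < Real.sin (Real.pi * (x + y) / 2) := by
    rw [mul_div_assoc]
    exact Real.sin_pi_mul_pos (by linarith [hx.1, hy.1]) (by linarith [hx.2, hy.2])
  have h4 : 0 < Real.Gamma (2 * x + 1) := Real.Gamma_pos_of_pos (by linarith [hx.1])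
  have h5 : 0 < Real.Gamma (2 * y + 1) := Real.Gamma_pos_of_pos (by linarith [hy.1])
  have h6 : 0 < Real.Gamma (x + y + 1) := Real.Gamma_pos_of_pos (by linarith [hx.1, hy.1])
  unfold mbmD
  positivity

theorem exists_mbmD_le {μ ν : ℝ} (hμ : 0 < μ) (hν : ν < 1) :
    ∃ A : ℝ, ∀ x ∈ Set.Icc μ ν, ∀ y ∈ Set.Icc μ ν, mbmD x y ≤ A := by
  have hc : ContinuousOn (fun z : ℝ × ℝ => mbmD z.1 z.2) (Set.Icc μ ν ×ˢ Set.Icc μ ν) := by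
    have hG : ∀ f : ℝ × ℝ → ℝ, Continuous f →
        (∀ z ∈ Set.Icc μ ν ×ˢ Set.Icc μ ν, 0 < f z) →
        ContinuousOn (fun z => Real.Gamma (f z)) (Set.Icc μ ν ×ˢ Set.Icc μ ν) := by
      intro f hf hpos z hz
      refine ContinuousAt.continuousWithinAt (ContinuousAt.comp (g := Real.Gamma) ?_ hf.continuousAt)
      exact (Real.differentiableAt_Gamma fun m => by
        have := hpos z hz
        have hm : (0 : ℝ) ≤ m := m.cast_nonneg
        linarith).continuousAt
    unfold mbmD
    refine ContinuousOn.div ?_ ?_ ?_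
    · refine ((((hG _ (by fun_prop) ?_).mul (hG _ (by fun_prop) ?_)).mul
        (by fun_prop)).mul (by fun_prop)).sqrt
      · rintro z ⟨h1, h2⟩; linarith [h1.1]
      · rintro z ⟨h1, h2⟩; linarith [h2.1]
    · refine (continuousOn_const.mul (hG _ (by fun_prop) ?_)).mul (by fun_prop)
      rintro z ⟨h1, h2⟩; linarith [h1.1, h2.1]
    · rintro z ⟨h1, h2⟩
      have h3 : 0 < Real.sin (Real.pi * (z.1 + z.2) / 2) := by
        rw [mul_div_assoc]
        exact Real.sin_pi_mul_pos (by linarith [h1.1, h2.1]) (by linarith [h1.2, h2.2])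
      have h6 : 0 < Real.Gamma (z.1 + z.2 + 1) :=
        Real.Gamma_pos_of_pos (by linarith [h1.1, h2.1])
      positivity
  obtain ⟨A, hA⟩ := (isCompact_Icc.prod isCompact_Icc).exists_bound_of_continuousOn hc
  exact ⟨A, fun x hx y hy => (le_abs_self _).trans (hA (x, y) ⟨hx, hy⟩)⟩

/-- `(2D)^2` is a Gamma quotient, at least `1` by log-convexity, times a sine quotient equal to `1 -
sin²(π(x-y)/2) / sin²(π(x+y)/2)`. -/
theorem one_sub_le_two_mul_mbmD_sq {x y c : ℝ} (hx : x ∈ Set.Ioo (0 : ℝ) 1)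
    (hy : y ∈ Set.Ioo (0 : ℝ) 1) (hc : 0 < c) (hcs : c ≤ Real.sin (Real.pi * ((x + y) / 2))) :
    1 - (Real.pi / (2 * c)) ^ 2 * (x - y) ^ 2 ≤ (2 * mbmD x y) ^ 2 := by
  have h1 := Real.sin_pi_mul_pos hx.1 hx.2
  have h2 := Real.sin_pi_mul_pos hy.1 hy.2
  have h4 : 0 < Real.Gamma (2 * x + 1) := Real.Gamma_pos_of_pos (by linarith [hx.1])
  have h5 : 0 < Real.Gamma (2 * y + 1) := Real.Gamma_pos_of_pos (by linarith [hy.1])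
  have h6 : 0 < Real.Gamma (x + y + 1) := Real.Gamma_pos_of_pos (by linarith [hx.1, hy.1])
  have hG : Real.Gamma (x + y + 1) ^ 2 ≤ Real.Gamma (2 * x + 1) * Real.Gamma (2 * y + 1) := by
    have h := Real.Gamma_midpoint_sq_le (x := 2 * x + 1) (y := 2 * y + 1)
      (by linarith [hx.1]) (by linarith [hy.1])
    rwa [show (2 * x + 1 + (2 * y + 1)) / 2 = x + y + 1 by ring] at h
  rw [← mul_div_assoc] at hcs
  have hsin := Real.sin_mul_sin_eq_sq_sub_sq (Real.pi * x) (Real.pi * y)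
  rw [← mul_add, ← mul_sub] at hsin
  have hδ : Real.sin (Real.pi * (x - y) / 2) ^ 2 ≤ (Real.pi * (x - y) / 2) ^ 2 :=
    sq_le_sq.2 Real.abs_sin_le_abs
  set S := Real.sin (Real.pi * (x + y) / 2) with hS
  have hS0 : 0 < S := hc.trans_le hcs
  have e : (2 * mbmD x y) ^ 2 = Real.Gamma (2 * x + 1) * Real.Gamma (2 * y + 1)
      / Real.Gamma (x + y + 1) ^ 2 * (Real.sin (Real.pi * x) * Real.sin (Real.pi * y) / S ^ 2) := by
    rw [mbmD, ← hS, mul_pow, div_pow, Real.sq_sqrt (by positivity)]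
    clear_value S
    generalize Real.sin (Real.pi * x) = S₁
    generalize Real.sin (Real.pi * y) = S₂
    field_simp
  have hfac : 1 ≤ Real.Gamma (2 * x + 1) * Real.Gamma (2 * y + 1) / Real.Gamma (x + y + 1) ^ 2 :=
    (one_le_div (by positivity)).2 hG
  have hsp : 0 ≤ Real.sin (Real.pi * x) * Real.sin (Real.pi * y) / S ^ 2 := by positivity
  rw [e]
  refine le_trans ?_ (le_mul_of_one_le_left hsp hfac)
  rw [hsin, sub_div, div_self (by positivity)]
  refine sub_le_sub_left ?_ 1
  calc Real.sin (Real.pi * (x - y) / 2) ^ 2 / S ^ 2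
      ≤ (Real.pi * (x - y) / 2) ^ 2 / c ^ 2 :=
        div_le_div₀ (sq_nonneg _) hδ (by positivity) (pow_le_pow_left₀ hc.le hcs 2)
    _ = _ := by field_simp

/-! ### Comparison of powers -/

theorem one_sub_le_rpow_of_one_sub_le_sq {d z K : ℝ} (hd : 0 ≤ d) (hz : 0 ≤ z)
    (hK : 0 ≤ K) (hK2 : K ≤ 2) (h : 1 - z ≤ d ^ 2) : 1 - z ≤ d ^ K := by
  rcases le_or_gt d 1 with h1 | h1
  · refine h.trans ?_
    rw [← Real.rpow_two]
    exact Real.rpow_le_rpow_of_exponent_ge' hd h1 hK hK2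
  · have := Real.one_le_rpow h1.le hK
    linarith

theorem rpow_add_rpow_le_two_mul_rpow_midpoint {x y K : ℝ} (hx : 0 ≤ x) (hy : 0 ≤ y)
    (hK : 0 ≤ K) (hK1 : K ≤ 1) : x ^ K + y ^ K ≤ 2 * ((x + y) / 2) ^ K := by
  have h := (Real.concaveOn_rpow hK hK1).2 hx hy (show (0 : ℝ) ≤ 1 / 2 by norm_num)
    (show (0 : ℝ) ≤ 1 / 2 by norm_num) (by norm_num)
  simp only [smul_eq_mul] at h
  rw [show 1 / 2 * x + 1 / 2 * y = (x + y) / 2 by ring] at h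
  linarith

/-- The ratio is `exp ((b-a)(-log u))`, and `u^μ (-log u) ≤ 1/μ`. -/
theorem rpow_le_exp_mul_rpow {u a b L μ : ℝ} (hμ : 0 < μ) (hu : 0 < u)
    (h : b - a ≤ L * u ^ μ) (hL : 0 ≤ L) (hu1 : u ≤ 1) :
    u ^ a ≤ Real.exp (L / μ) * u ^ b := by
  have hlog : Real.log u ≤ 0 := Real.log_nonpos hu.le hu1
  rw [Real.rpow_def_of_pos hu, Real.rpow_def_of_pos hu, ← Real.exp_add]
  refine Real.exp_le_exp.2 ?_
  have h3 : u ^ μ * (-Real.log u) ≤ 1 / μ := by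
    have h := Real.add_one_le_exp (-(Real.log u * μ))
    have h4 : u ^ μ * Real.exp (-(Real.log u * μ)) = 1 := by
      rw [Real.rpow_def_of_pos hu, ← Real.exp_add]; simp
    have h5 : 0 < u ^ μ := Real.rpow_pos_of_pos hu μ
    rw [le_div_iff₀ hμ]
    nlinarith [mul_le_mul_of_nonneg_left h h5.le]
  have h4 := mul_le_mul_of_nonneg_right h (neg_nonneg.2 hlog)
  have h5 := mul_le_mul_of_nonneg_left h3 hL
  rw [mul_one_div] at h5
  linarith

/-! ### Covariance and increments -/

theorem multiBifBmCov_self {H : ℝ≥0 → ℝ} {K : ℝ} (hK : 0 < K) (t : ℝ≥0)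
    (h0 : 0 < H t) (h1 : H t < 1) : multiBifBmCov H K t t = (t : ℝ) ^ (2 * (H t * K)) := by
  have ht : (0 : ℝ) ≤ t := t.2
  rw [multiBifBmCov, mbmD_self h0 h1, sub_self, abs_zero,
    Real.zero_rpow (by positivity), sub_zero, ← Real.mul_rpow (by norm_num) (by positivity)]
  rw [show 1 / 2 * ((t : ℝ) ^ (H t + H t) + (t : ℝ) ^ (H t + H t)) = (t : ℝ) ^ (H t + H t) by ring,
    ← Real.rpow_mul ht]
  ring_nf

theorem integral_sub_sq_eq {Ω : Type*} [MeasurableSpace Ω] {P : Measure Ω}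
    [IsProbabilityMeasure P] {X Y : Ω → ℝ} (hX : MemLp X 2 P) (hY : MemLp Y 2 P)
    (hX0 : ∫ ω, X ω ∂P = 0) (hY0 : ∫ ω, Y ω ∂P = 0) :
    ∫ ω, (X ω - Y ω) ^ 2 ∂P = cov[X, X; P] + cov[Y, Y; P] - 2 * cov[X, Y; P] := by
  have h := variance_sub hX hY
  have h0 : P[X - Y] = 0 := by
    simp only [Pi.sub_apply]
    rw [integral_sub (hX.integrable one_le_two) (hY.integrable one_le_two), hX0, hY0, sub_zero]
  rw [variance_of_integral_eq_zero (hX.sub hY).aemeasurable h0,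
    ← covariance_self hX.aemeasurable, ← covariance_self hY.aemeasurable] at h
  simp only [Pi.sub_apply] at h
  rw [h]; ring

theorem multiBifBmCov_increment_le {H : ℝ≥0 → ℝ} {K c m A : ℝ} {s t : ℝ≥0}
    (hK : K ∈ Set.Ioc (0 : ℝ) 1) (hs : s ≤ 1) (ht : t ≤ 1)
    (hHt : H t ∈ Set.Ioo (0 : ℝ) 1) (hHs : H s ∈ Set.Ioo (0 : ℝ) 1) (hc : 0 < c)
    (hcs : c ≤ Real.sin (Real.pi * ((H t + H s) / 2))) (hA : mbmD (H t) (H s) ≤ A)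
    (hA1 : 1 ≤ A) (hm : m = min (H t * K) (H s * K)) :
    multiBifBmCov H K t t + multiBifBmCov H K s s - 2 * multiBifBmCov H K t s
      ≤ (|H t * K - H s * K| / m) ^ 2
        + 3 * |H t * K - H s * K| / m * |(t : ℝ) - (s : ℝ)| ^ m
        + 2 * ((Real.pi / (2 * c)) ^ 2 * (H t - H s) ^ 2)
        + 2 * (A * |(t : ℝ) - (s : ℝ)| ^ ((H t + H s) * K)) := by
  have ht0 : (0 : ℝ) ≤ t := t.2
  have hs0 : (0 : ℝ) ≤ s := s.2
  have ht1 : (t : ℝ) ≤ 1 := ht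
  have hs1 : (s : ℝ) ≤ 1 := hs
  have hab : 0 ≤ H t + H s := by linarith [hHt.1, hHs.1]
  rw [multiBifBmCov_self hK.1 t hHt.1 hHt.2, multiBifBmCov_self hK.1 s hHs.1 hHs.2, multiBifBmCov]
  have hp := mul_pos hHt.1 hK.1
  have hq := mul_pos hHs.1 hK.1
  have hcross := rpow_cross_difference_le (m := m) (p := H t * K) (q := H s * K) (s := s) (t := t)
    (hm ▸ lt_min hp hq)
    (hm ▸ (min_le_left _ _).trans (mul_le_one₀ hHt.2.le hK.1.le hK.2)) hm ⟨hs0, hs1⟩ ⟨ht0, ht1⟩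
  have hD := mbmD_pos hHt hHs
  have hone := one_sub_le_two_mul_mbmD_sq hHt hHs hc hcs
  set D := mbmD (H t) (H s)
  set z := (Real.pi / (2 * c)) ^ 2 * (H t - H s) ^ 2
  have hz : 0 ≤ z := by positivity
  set x := (t : ℝ) ^ (H t + H s) with hx
  set y := (s : ℝ) ^ (H t + H s) with hy
  have hx0 : 0 ≤ x := Real.rpow_nonneg ht0 _
  have hy0 : 0 ≤ y := Real.rpow_nonneg hs0 _
  have hx1 : x ≤ 1 := Real.rpow_le_one ht0 ht1 hab
  have hy1 : y ≤ 1 := Real.rpow_le_one hs0 hs1 hab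
  have hxK : (t : ℝ) ^ (H t * K + H s * K) = x ^ K := by
    rw [hx, ← Real.rpow_mul ht0, add_mul]
  have hyK : (s : ℝ) ^ (H t * K + H s * K) = y ^ K := by
    rw [hy, ← Real.rpow_mul hs0, add_mul]
  rw [hxK, hyK] at hcross
  have hmid := rpow_add_rpow_le_two_mul_rpow_midpoint hx0 hy0 hK.1.le hK.2
  have hDK := one_sub_le_rpow_of_one_sub_le_sq (by positivity) hz hK.1.le
    (hK.2.trans one_le_two) hone
  have hw0 : 0 ≤ ((x + y) / 2) ^ K := by positivity
  have hw1 : ((x + y) / 2) ^ K ≤ 1 :=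
    Real.rpow_le_one (by positivity) (by linarith) hK.1.le
  -- Moving the factor `2` onto `D` isolates the quantity close to `1` and leaves the midpoint of
  -- `x` and `y`.
  have hprod : D ^ K * (x + y) ^ K = (2 * D) ^ K * ((x + y) / 2) ^ K := by
    rw [← Real.mul_rpow hD.le (by positivity), ← Real.mul_rpow (by positivity) (by positivity)]
    ring_nf
  have hDA : D ^ K ≤ A :=
    (Real.rpow_le_rpow hD.le hA hK.1.le).trans (Real.rpow_le_self_of_one_le hA1 hK.2)
  have hu := mul_le_mul_of_nonneg_right hDA
    (Real.rpow_nonneg (abs_nonneg ((t : ℝ) - s)) ((H t + H s) * K))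
  have h1 := mul_le_mul_of_nonneg_right hDK hw0
  have h2 := mul_le_mul_of_nonneg_left hw1 hz
  rw [mul_sub, hprod]
  linarith

theorem theorem1 (μ ν K : ℝ) (hμ : 0 < μ) (hν : ν < 1) (hK : K ∈ Set.Ioc (0 : ℝ) 1) (L : ℝ≥0) :
    ∃ C : ℝ, 0 < C ∧
      ∀ (β : ℝ≥0) (H : ℝ≥0 → ℝ), 0 < β → (∀ t, H t ∈ Set.Icc μ ν) → HolderWith L β H →
        (⨆ t, H t) < (β : ℝ) →
        ∀ (Ω : Type*) [MeasurableSpace Ω] (P : Measure Ω) [IsProbabilityMeasure P]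
          (B : ℝ≥0 → Ω → ℝ), IsMultiBifBm P H K B →
          ∀ t ∈ Set.Icc (0 : ℝ≥0) 1, ∀ s ∈ Set.Icc (0 : ℝ≥0) 1,
            ∫ ω, (B t ω - B s ω) ^ 2 ∂P
              ≤ C * |(t : ℝ) - (s : ℝ)| ^ (2 * max (H t) (H s) * K) := by
  obtain ⟨A₀, hA₀⟩ := exists_mbmD_le hμ hν
  obtain ⟨c, hc, hcs⟩ : ∃ c : ℝ, 0 < c ∧ ∀ x ∈ Set.Icc μ ν, c ≤ Real.sin (Real.pi * x) :=
    isCompact_Icc.exists_forall_le' (by fun_prop)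
      fun x hx => Real.sin_pi_mul_pos (hμ.trans_le hx.1) (hx.2.trans_lt hν)
  set A := max 1 A₀
  have hA1 : 1 ≤ A := le_max_left _ _
  set E := Real.exp (L / μ)
  have hE : 0 < E := Real.exp_pos _
  have hL : (0 : ℝ) ≤ L := L.2
  have hK0 := hK.1
  have hμK : 0 < μ * K := mul_pos hμ hK0
  -- The summands match the four terms of `multiBifBmCov_increment_le`.
  refine ⟨(L / (μ * K)) ^ 2 + 3 * L / (μ * K) * E + 2 * ((Real.pi / (2 * c)) ^ 2 * L ^ 2)
    + 2 * (A * E), by positivity, ?_⟩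
  intro β H _ hH hHol hsup Ω _ P _ B hB t ht s hs
  have hHβ : ∀ r, H r < β := fun r =>
    -- The bound `ν` is required: a real supremum of an unbounded family defaults to `0`.
    (le_ciSup (f := H) ⟨ν, by rintro _ ⟨r, rfl⟩; exact (hH r).2⟩ r).trans_lt hsup
  have hI : ∀ r, H r ∈ Set.Ioo (0 : ℝ) 1 := fun r =>
    ⟨hμ.trans_le (hH r).1, (hH r).2.trans_lt hν⟩
  have hmem : ∀ r, MemLp (B r) 2 P := fun r =>
    (hB.isGaussianProcess.hasGaussianLaw_eval r).memLp_two
  rw [integral_sub_sq_eq (hmem t) (hmem s) (hB.centred t) (hB.centred s),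
    hB.covariance_eq, hB.covariance_eq, hB.covariance_eq]
  rcases eq_or_ne t s with rfl | hts
  · rw [show ∀ x : ℝ, x + x - 2 * x = 0 from fun x => by ring]
    positivity
  have hinc := multiBifBmCov_increment_le (m := min (H t * K) (H s * K)) (A := A) hK hs.2 ht.2 (hI t) (hI s)
    hc (hcs _ ⟨by linarith [(hH t).1, (hH s).1], by linarith [(hH t).2, (hH s).2]⟩)
    ((hA₀ _ (hH t) _ (hH s)).trans (le_max_right 1 A₀)) hA1 rfl
  refine hinc.trans ?_
  set u := |(t : ℝ) - (s : ℝ)| with hu_def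
  have hu0 : 0 < u := abs_pos.2 (sub_ne_zero.2 fun h => hts (NNReal.coe_injective h))
  have hu1 : u ≤ 1 := by
    have h1 : (t : ℝ) ≤ 1 := ht.2
    have h2 : (s : ℝ) ≤ 1 := hs.2
    have h3 : (0 : ℝ) ≤ t := t.2
    have h4 : (0 : ℝ) ≤ s := s.2
    rw [hu_def, abs_le]; constructor <;> linarith
  have hHd : |H t - H s| ≤ L * u ^ (β : ℝ) := by
    have h := hHol.dist_le t s
    rwa [Real.dist_eq, NNReal.dist_eq] at h
  have hpow : ∀ x : ℝ, x ≤ β → |H t - H s| ≤ L * u ^ x := fun x hx =>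
    hHd.trans (mul_le_mul_of_nonneg_left (Real.rpow_le_rpow_of_exponent_ge hu0 hu1 hx) hL)
  have hdμ : |H t - H s| ≤ L * u ^ μ := hpow μ ((hH t).1.trans (hHβ t).le)
  have hdK : |H t * K - H s * K| ≤ |H t - H s| := by
    rw [← sub_mul, abs_mul, abs_of_pos hK0]
    exact mul_le_of_le_one_right (abs_nonneg _) hK.2
  set M := max (H t) (H s)
  have hM0 : 0 < M := (hI t).1.trans_le (le_max_left _ _)
  have hMβ : M ≤ β := max_le (hHβ t).le (hHβ s).le
  set V := u ^ (M * K)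
  have hV : 0 < V := Real.rpow_pos_of_pos hu0 _
  -- Here `sup H < β` is decisive: `u^β ≤ u^(M*K)` because `u ≤ 1`.
  have hdV : |H t - H s| ≤ L * V :=
    hpow (M * K) ((mul_le_of_le_one_right hM0.le hK.2).trans hMβ)
  have hVV : u ^ (2 * M * K) = V ^ 2 := by
    rw [← Real.rpow_mul_natCast hu0.le]; push_cast; ring_nf
  have hmax : max (H t * K) (H s * K) = M * K := (max_mul_of_nonneg _ _ hK0.le).symm
  have hdiff : M * K - min (H t * K) (H s * K) = |H t * K - H s * K| := by
    rw [← hmax, max_sub_min_eq_abs]; exact abs_sub_comm _ _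
  have hmV : u ^ min (H t * K) (H s * K) ≤ E * V :=
    rpow_le_exp_mul_rpow hμ hu0 (by rw [hdiff]; exact hdK.trans hdμ) hL hu1
  have hsum : M * K + min (H t * K) (H s * K) = (H t + H s) * K := by
    rw [← hmax, max_add_min, add_mul]
  have hsV : u ^ ((H t + H s) * K) ≤ E * V ^ 2 := by
    rw [← hsum, Real.rpow_add hu0]
    calc V * _ ≤ V * (E * V) := mul_le_mul_of_nonneg_left hmV hV.le
      _ = _ := by ring
  have hmμ : μ * K ≤ min (H t * K) (H s * K) :=
    le_min (mul_le_mul_of_nonneg_right (hH t).1 hK0.le)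
      (mul_le_mul_of_nonneg_right (hH s).1 hK0.le)
  have hquot : |H t * K - H s * K| / min (H t * K) (H s * K) ≤ L / (μ * K) * V := by
    rw [div_mul_eq_mul_div]
    exact div_le_div₀ (by positivity) (hdK.trans hdV) hμK hmμ
  have hquot0 : 0 ≤ |H t * K - H s * K| / min (H t * K) (H s * K) :=
    div_nonneg (abs_nonneg _) (hμK.le.trans hmμ)
  have h1 := pow_le_pow_left₀ hquot0 hquot 2
  have h2 := mul_le_mul hquot hmV (Real.rpow_nonneg hu0.le _) (by positivity)
  have h3 : (H t - H s) ^ 2 ≤ (L * V) ^ 2 := by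
    rw [← sq_abs]; exact pow_le_pow_left₀ (abs_nonneg _) hdV 2
  have h4 := mul_le_mul_of_nonneg_left h3 (sq_nonneg (Real.pi / (2 * c)))
  have h5 := mul_le_mul_of_nonneg_left hsV (zero_le_one.trans hA1)
  rw [hVV]
  have e1 : 3 * |H t * K - H s * K| / min (H t * K) (H s * K) * u ^ min (H t * K) (H s * K)
      = 3 * (|H t * K - H s * K| / min (H t * K) (H s * K) * u ^ min (H t * K) (H s * K)) := by
    ring
  have e2 : ((L / (μ * K)) ^ 2 + 3 * L / (μ * K) * E + 2 * ((Real.pi / (2 * c)) ^ 2 * L ^ 2)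
      + 2 * (A * E)) * V ^ 2 = (L / (μ * K) * V) ^ 2 + 3 * (L / (μ * K) * V * (E * V))
      + 2 * ((Real.pi / (2 * c)) ^ 2 * (L * V) ^ 2) + 2 * (A * (E * V ^ 2)) := by ring
  rw [e1, e2]
  linarith
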